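/- Let $k$ be a field and $C$ a $k$-coalgebra, with convolution algebra $C^*=\mathrm{Hom}_k(C,k)$. For a right $C$-comodule $(M,\rho)$, $C^*$ acts on $M$ by $f\cdot m=\sum m_{(0)}f(m_{(1)})$. For a subspace $N\subseteq M$ and $P\subseteq C^*$ put $$N^{\bot C^*}=\{f\in C^*\mid f\cdot N=0\},\quad P^{\bot M}=\{x\in M\mid P\cdot x=0\},\quad P^{\bot C}=\{c\in C\mid P(c)=0\},\quad \langle N\rangle=N^{\bot C^*\bot M}.$$ A subcomodule $N$ is *closed* if $\langle N\rangle=N$, and *weak-closed* if $\langle C^*x\rangle\subseteq N$ for all $x\in N$. A *minimal closed* subcomodule is a closed subcomodule $N$ containing no non-zero closed subcomodule other than $N$; a *simple* subcoalgebra is a subcoalgebra $D$ containing no non-zero subcoalgebra other than $D$ (so zero is included in both cases). For a subcomodule $N$, $C(N)\subseteq C$ is the span of all coefficients $c_\lambda$ occurring in $\rho(m)=\sum_\lambda b_\lambda\otimes c_\lambda$, $m\in N$, for a basis $(b_\lambda)$ of $N$. For a subcoalgebra $E$, $M_E$ is the sum of all subcomodules $N$ of $M$ with $\rho(N)\subseteq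 N\otimes E$. For subspaces $X,Y$ of $C$, $X\wedge_C Y$ is the kernel of $C\xrightarrow{\Delta}C\otimes C\to C/X\otimes C/Y$; for subcomodules $N,L$ of $M$, $N\wedge_M L=(N^{\bot C^*}L^{\bot C^*})^{\bot M}$. For simple subcoalgebras $D,E$ of $C$ write $D\sim E$ if for every partition of the set of simple subcoalgebras of $C$ into two disjoint subsets $\mathcal C_1\ni D$, $\mathcal C_2\ni E$ there are $D_1\in\mathcal C_1$, $E_1\in\mathcal C_2$ with $D_1\wedge_C E_1\ne E_1\wedge_C D_1$; define $\sim$ on the minimal closed subcomodules of $M$ in the same way using $\wedge_M$. The comodule $M$ is *full* if $C(M)=C$; *$W$-relational hereditary* if $D\sim E$ implies $M_D\sim M_E$ for all simple subcoalgebras $D,E\subseteq C(M)$; and *component faithful* if $M_D\neq0$ for every non-zero simple subcoalgebra $D$ of $C$. A comodule (resp. coalgebra) is *indecomposable* if it is not the direct sum of two non-zero weak-closed subcomodules (resp. two non-zero subcoalgebras). A *weak-closed indecomposable decomposition* of $M$ is a set of non-zero indecomposable weak-closed subcomodules whose internal direct sum is $M$; an *indecomposable decomposition* of $C$ is a set of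 non-zero indecomposable subcoalgebras whose internal direct sum is $C$. **Proposition 1.17.** Let $M=C$ be the regular right $C$-comodule ($\rho=\Delta$), so that its subcomodules are the right coideals of $C$. 1. $X^{\bot C}=X^{\bot M}$ for every two-sided ideal $X$ of $C^*$; $N^{\bot C^*\bot M}=C(N)$ for every subcomodule $N$ of $M$; and $C(M_F)=F$ for every subcoalgebra $F$ of $C$. 2. A subspace $N$ of $C$ is a closed subcomodule of $M$ iff it is a subcoalgebra of $C$. 3. A subspace $N$ of $C$ is a closed subcomodule of $M$ iff it is a weak-closed subcomodule of $M$. 4. A subspace $N$ of $C$ is a minimal closed subcomodule of $M$ iff it is a simple subcoalgebra of $C$. 5. If $N$ and $L$ are closed subcomodules of $M$, then $N\wedge_M L=N\wedge_C L$. 6. $M$ is full, $W$-relational hereditary and component faithful. 7. $M$ has exactly one weak-closed indecomposable decomposition, $C$ has exactly one indecomposable decomposition, and the two coincide. -/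

import Mathlib

open scoped TensorProduct

namespace ComoduleDecomp

/-- The dual algebra `C^*`, with the convolution product `(f * g)(c) = ∑ f(c₁) g(c₂)`. -/
abbrev DualAlg (k C : Type*) [Field k] [AddCommGroup C] [Module k C] : Type _ :=
  WithConv (C →ₗ[k] k)

/-- A right `C`-comodule structure on the vector space `M`. -/
class RightComodule (k C M : Type*) [Field k] [AddCommGroup C] [Module k C] [Coalgebra k C]
    [AddCommGroup M] [Module k M] where
  /-- the coaction `ρ : M → M ⊗ C` -/
  coact : M →ₗ[k] M ⊗[k] C
  /-- `(ρ ⊗ id) ∘ ρ = (id ⊗ Δ) ∘ ρ` -/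
  coassoc : (TensorProduct.assoc k M C C).toLinearMap ∘ₗ coact.rTensor C ∘ₗ coact =
    (Coalgebra.comul (R := k) (A := C)).lTensor M ∘ₗ coact
  /-- `(id ⊗ ε) ∘ ρ = id` -/
  counit : (TensorProduct.rid k M).toLinearMap ∘ₗ
    (Coalgebra.counit (R := k) (A := C)).lTensor M ∘ₗ coact = LinearMap.id

/-- The regular right comodule: `M = C` with `ρ = Δ`. -/
instance regular (k C : Type*) [Field k] [AddCommGroup C] [Module k C] [Coalgebra k C] :
    RightComodule k C C where
  coact := Coalgebra.comul
  coassoc := Coalgebra.coassoc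
  counit := by
    ext x
    simp

section Coalg

variable {k C : Type*} [Field k] [AddCommGroup C] [Module k C] [Coalgebra k C]

/-- `Δ(D) ⊆ D ⊗ D`, where `D ⊗ D` is seen inside `C ⊗ C`. -/
def IsSubcoalgebra (D : Submodule k C) : Prop :=
  ∀ d ∈ D, Coalgebra.comul (R := k) d ∈
    LinearMap.range (TensorProduct.map D.subtype D.subtype)

/-- Simple subcoalgebras; by convention the zero subcoalgebra is included. -/
def IsSimpleSubcoalgebra (D : Submodule k C) : Prop :=
  IsSubcoalgebra D ∧ ∀ F : Submodule k C, IsSubcoalgebra F → F ≤ D → F ≠ ⊥ → F = D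

/-- `P^{⊥C} = {c ∈ C | P(c) = 0}`. -/
def perpC (P : Set (DualAlg k C)) : Submodule k C where
  carrier := {c | ∀ f ∈ P, f.ofConv c = 0}
  add_mem' := by
    intro a b ha hb f hf
    rw [map_add, ha f hf, hb f hf, add_zero]
  zero_mem' := by
    intro f _
    exact map_zero _
  smul_mem' := by
    intro r a ha f hf
    rw [map_smul, ha f hf, smul_zero]

/-- The wedge `X ∧ Y`: the kernel of `C → C ⊗ C → C/X ⊗ C/Y`. -/
def wedgeC (X Y : Submodule k C) : Submodule k C :=
  LinearMap.ker (TensorProduct.map X.mkQ Y.mkQ ∘ₗ Coalgebra.comul (R := k) (A := C))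

/-- The relation `D ∼ E` on simple subcoalgebras: every partition of the set of simple
subcoalgebras into two pieces separating `D` from `E` has non-commuting wedges across it. -/
def LinkedC (D E : Submodule k C) : Prop :=
  IsSimpleSubcoalgebra D ∧ IsSimpleSubcoalgebra E ∧
    ∀ C₁ C₂ : Set (Submodule k C),
      C₁ ∪ C₂ = {F | IsSimpleSubcoalgebra F} → C₁ ∩ C₂ = ∅ → D ∈ C₁ → E ∈ C₂ →
        ∃ D₁ ∈ C₁, ∃ E₁ ∈ C₂, wedgeC D₁ E₁ ≠ wedgeC E₁ D₁

/-- The subcoalgebra `D` is the direct sum of two non-zero subcoalgebras. -/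
def IsDecomposableSubcoalgebra (D : Submodule k C) : Prop :=
  ∃ A B : Submodule k C, IsSubcoalgebra A ∧ IsSubcoalgebra B ∧ A ≠ ⊥ ∧ B ≠ ⊥ ∧
    Disjoint A B ∧ A ⊔ B = D

/-- `C` is the internal direct sum of the members of `S`, and these are non-zero
indecomposable subcoalgebras. -/
def IsIndecDecompositionC (S : Set (Submodule k C)) : Prop :=
  sSupIndep S ∧ sSup S = ⊤ ∧
    ∀ D ∈ S, IsSubcoalgebra D ∧ D ≠ ⊥ ∧ ¬ IsDecomposableSubcoalgebra D

end Coalg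

section Comod

variable {k : Type*} (C : Type*) {M : Type*} [Field k] [AddCommGroup C] [Module k C]
  [Coalgebra k C] [AddCommGroup M] [Module k M] [RightComodule k C M]

/-- The coaction `ρ`, with explicit coalgebra. -/
def rho : M →ₗ[k] M ⊗[k] C := RightComodule.coact

variable {C} in
/-- The action of `C^*` on `M`: `f · m = ∑ m₀ f(m₁)`. -/
def act (f : DualAlg k C) : M →ₗ[k] M :=
  (TensorProduct.rid k M).toLinearMap ∘ₗ f.ofConv.lTensor M ∘ₗ rho C

/-- `ρ(N) ⊆ N ⊗ E`, where `N ⊗ E` is seen inside `M ⊗ C`. -/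
def CoactsIn (N : Submodule k M) (E : Submodule k C) : Prop :=
  ∀ m ∈ N, rho C m ∈ LinearMap.range (TensorProduct.map N.subtype E.subtype)

/-- Subcomodules: `ρ(N) ⊆ N ⊗ C`. For `M = C` these are the right coideals. -/
def IsSubcomodule (N : Submodule k M) : Prop :=
  ∀ m ∈ N, rho C m ∈ LinearMap.range (N.subtype.rTensor C)

/-- `N^{⊥C^*} = {f ∈ C^* | f · N = 0}`. -/
def annDual (N : Submodule k M) : Set (DualAlg k C) :=
  {f | ∀ x ∈ N, act f x = 0}

variable {C} in
/-- `P^{⊥M} = {x ∈ M | P · x = 0}`. -/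
def perpM (P : Set (DualAlg k C)) : Submodule k M where
  carrier := {x | ∀ f ∈ P, act f x = 0}
  add_mem' := by
    intro a b ha hb f hf
    rw [map_add, ha f hf, hb f hf, add_zero]
  zero_mem' := by
    intro f _
    exact map_zero _
  smul_mem' := by
    intro r a ha f hf
    rw [map_smul, ha f hf, smul_zero]

/-- The closure `<N> = N^{⊥C^*⊥M}`. -/
def closureM (N : Submodule k M) : Submodule k M := perpM (annDual C N)

/-- The subspace `C^* x`. -/
def orbit (x : M) : Submodule k M :=
  Submodule.span k (Set.range fun f : DualAlg k C => act f x)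

/-- Closed subcomodules: `<N> = N`. -/
def IsClosedSubcomodule (N : Submodule k M) : Prop :=
  IsSubcomodule C N ∧ closureM C N = N

/-- Weak-closed subcomodules: `<x> = <C^* x> ⊆ N` for every `x ∈ N`. -/
def IsWeakClosedSubcomodule (N : Submodule k M) : Prop :=
  IsSubcomodule C N ∧ ∀ x ∈ N, closureM C (orbit C x) ≤ N

/-- Minimal closed subcomodules; by convention the zero subcomodule is included. -/
def IsMinimalClosedSubcomodule (N : Submodule k M) : Prop :=
  IsClosedSubcomodule C N ∧
    ∀ L : Submodule k M, IsClosedSubcomodule C L → L ≤ N → L ≠ ⊥ → L = N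

variable {C} in
variable (M) in
/-- The component `M_E`: the sum of all subcomodules `N` with `ρ(N) ⊆ N ⊗ E`. -/
def component (E : Submodule k C) : Submodule k M :=
  sSup {N : Submodule k M | IsSubcomodule C N ∧ CoactsIn C N E}

/-- All coefficients `c_λ₀` that occur when `ρ(m)`, for `m ∈ N`, is written as `∑ b_λ ⊗ c_λ`
in the given basis `b` of `N`. -/
def coeffSet {ι : Type*} (N : Submodule k M) (b : Module.Basis ι k N) : Set C :=
  {d | ∃ m ∈ N, ∃ c : ι →₀ C,
    rho C m = c.sum (fun i e => ((b i : N) : M) ⊗ₜ[k] e) ∧ ∃ i, c i = d}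

/-- `C(N)`: the subspace of `C` spanned by the coefficients of `ρ` on `N` with respect to a
basis of `N` (the span does not depend on the basis). -/
noncomputable def coeffSpace (N : Submodule k M) : Submodule k C :=
  Submodule.span k (coeffSet C N (Module.Basis.ofVectorSpace k N))

/-- The wedge of two subcomodules: `N ∧_M L = (N^{⊥C^*} L^{⊥C^*})^{⊥M}`. -/
def wedgeM (N L : Submodule k M) : Submodule k M :=
  perpM {h : DualAlg k C | ∃ f ∈ annDual C N, ∃ g ∈ annDual C L, h = f * g}

/-- The relation `N ∼ L` on minimal closed subcomodules, defined as for simple subcoalgebras. -/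
def LinkedM (N L : Submodule k M) : Prop :=
  IsMinimalClosedSubcomodule C N ∧ IsMinimalClosedSubcomodule C L ∧
    ∀ M₁ M₂ : Set (Submodule k M),
      M₁ ∪ M₂ = {T | IsMinimalClosedSubcomodule C T} → M₁ ∩ M₂ = ∅ → N ∈ M₁ → L ∈ M₂ →
        ∃ N₁ ∈ M₁, ∃ L₁ ∈ M₂, wedgeM C N₁ L₁ ≠ wedgeM C L₁ N₁

variable (k M)

/-- `M` is full: `C(M) = C`. -/
def IsFull : Prop := coeffSpace C (⊤ : Submodule k M) = ⊤

/-- Every simple subcoalgebra `D` is faithful to `M`: `M_D ≠ 0` or `D = 0`. -/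
def IsComponentFaithful : Prop :=
  ∀ D : Submodule k C, IsSimpleSubcoalgebra D → component M D ≠ ⊥ ∨ D = ⊥

/-- `D ∼ E` implies `M_D ∼ M_E` for all simple subcoalgebras `D`, `E` contained in `C(M)`. -/
def IsWRelationalHereditary : Prop :=
  ∀ D E : Submodule k C, IsSimpleSubcoalgebra D → IsSimpleSubcoalgebra E →
    D ≤ coeffSpace C (⊤ : Submodule k M) → E ≤ coeffSpace C (⊤ : Submodule k M) →
      LinkedC D E → LinkedM C (component M D) (component M E)

variable {k M}

/-- `P` is a weak-closed subcomodule of the comodule `N`; closures are taken inside `N`, that is,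
they are the intersections with `N` of the closures in `M`. -/
def IsWeakClosedIn (N P : Submodule k M) : Prop :=
  IsSubcomodule C P ∧ P ≤ N ∧ ∀ x ∈ P, closureM C (orbit C x) ⊓ N ≤ P

/-- The subcomodule `N`, as a comodule, is the direct sum of two non-zero weak-closed
subcomodules. -/
def IsDecomposableSubcomodule (N : Submodule k M) : Prop :=
  ∃ P Q : Submodule k M, IsWeakClosedIn C N P ∧ IsWeakClosedIn C N Q ∧ P ≠ ⊥ ∧ Q ≠ ⊥ ∧
    Disjoint P Q ∧ P ⊔ Q = N

/-- `M` is the internal direct sum of the members of `S`, and these are non-zero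
indecomposable weak-closed subcomodules. -/
def IsWeakClosedIndecDecomposition (S : Set (Submodule k M)) : Prop :=
  sSupIndep S ∧ sSup S = ⊤ ∧
    ∀ N ∈ S, IsWeakClosedSubcomodule C N ∧ N ≠ ⊥ ∧ ¬ IsDecomposableSubcomodule C N

end Comod

end ComoduleDecomp

/-! On `C` the dual algebra acts from both sides: `act f c` is `∑ c₁ f(c₂)` and `lact f c` is `∑
f(c₁) c₂`. The two actions commute; right coideals are the subspaces stable under `act`,
subcoalgebras those stable under both. For a right coideal `N`, a functional annihilates `N` iff it
vanishes on `lactSpan N`, the subcoalgebra generated by `N` (`mem_annDual_iff`). Hence the closure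
and the coefficient space of `N` are both `lactSpan N`, and every closure notion reduces to being a
subcoalgebra.

For the decomposition, any subcoalgebra `D` splits along a decomposition `C = A ⊕ B` into
subcoalgebras (`IsSubcoalgebra.le_sup_inf`). This supplies the distributivity needed to intersect
split subcoalgebras, and local finiteness extends it to filtered intersections (`isSplit_sInf`). The
least split subcoalgebra above a non-zero simple one is then a block. Distinct blocks are disjoint,
blocks sum to `C`, and an indecomposable decomposition has no choice but to consist of all blocks.
-/

namespace ComoduleDecomp

/-! ### Contractions of tensors by functionals -/

section Slices

variable {k V W : Type*} [Field k] [AddCommGroup V] [Module k V] [AddCommGroup W] [Module k W]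

/-- The contraction `id ⊗ f : V ⊗ W → V`. -/
def sliceRight (f : W →ₗ[k] k) : V ⊗[k] W →ₗ[k] V :=
  (TensorProduct.rid k V).toLinearMap ∘ₗ f.lTensor V

/-- The contraction `f ⊗ id : V ⊗ W → W`. -/
def sliceLeft (f : V →ₗ[k] k) : V ⊗[k] W →ₗ[k] W :=
  (TensorProduct.lid k W).toLinearMap ∘ₗ f.rTensor W

@[simp]
theorem sliceRight_tmul (f : W →ₗ[k] k) (v : V) (w : W) : sliceRight f (v ⊗ₜ[k] w) = f w • v := by
  simp [sliceRight]

@[simp]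
theorem sliceLeft_tmul (f : V →ₗ[k] k) (v : V) (w : W) : sliceLeft f (v ⊗ₜ[k] w) = f v • w := by
  simp [sliceLeft]

open scoped Classical in
theorem eq_zero_of_sliceRight {t : V ⊗[k] W} (h : ∀ f : W →ₗ[k] k, sliceRight f t = 0) :
    t = 0 := by
  let b := Module.Basis.ofVectorSpace k W
  apply (TensorProduct.equivFinsuppOfBasisRight (M := V) b).injective
  ext i
  rw [TensorProduct.equivFinsuppOfBasisRight_apply, map_zero]
  exact h (b.coord i)

open scoped Classical in
theorem eq_zero_of_sliceLeft {t : V ⊗[k] W} (h : ∀ f : V →ₗ[k] k, sliceLeft f t = 0) :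
    t = 0 := by
  let b := Module.Basis.ofVectorSpace k V
  apply (TensorProduct.equivFinsuppOfBasisLeft (N := W) b).injective
  ext i
  rw [TensorProduct.equivFinsuppOfBasisLeft_apply, map_zero]
  exact h (b.coord i)

theorem apply_sliceRight (f : V →ₗ[k] k) (g : W →ₗ[k] k) (t : V ⊗[k] W) :
    f (sliceRight g t) = g (sliceLeft f t) := by
  induction t with
  | zero => simp
  | tmul v w => simp [mul_comm]
  | add x y hx hy => simp [hx, hy]

/-- By right exactness the range is the kernel of `V ⊗ W → V/A ⊗ W`, and functionals on `W` detect
zero in `V/A ⊗ W`. -/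
theorem mem_range_rTensor_iff {A : Submodule k V} {t : V ⊗[k] W} :
    t ∈ LinearMap.range (A.subtype.rTensor W) ↔ ∀ f : W →ₗ[k] k, sliceRight f t ∈ A := by
  have hex := rTensor_exact W (LinearMap.exact_subtype_mkQ A) A.mkQ_surjective
  have key (f : W →ₗ[k] k) (s : V ⊗[k] W) :
      sliceRight f (A.mkQ.rTensor W s) = A.mkQ (sliceRight f s) := by
    induction s with
    | zero => simp
    | tmul v w => simp
    | add x y hx hy => simp [hx, hy]
  rw [← LinearMap.exact_iff.1 hex, LinearMap.mem_ker]
  constructor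
  · intro h f
    have := key f t
    rw [h, map_zero] at this
    simpa using this.symm
  · intro h
    apply eq_zero_of_sliceRight
    intro f
    rw [key]
    simpa using h f

theorem mem_range_map_iff {A : Submodule k V} {B : Submodule k W} {t : V ⊗[k] W} :
    t ∈ LinearMap.range (TensorProduct.map A.subtype B.subtype) ↔
      (∀ f : W →ₗ[k] k, sliceRight f t ∈ A) ∧ ∀ f : V →ₗ[k] k, sliceLeft f t ∈ B := by
  constructor
  · rintro ⟨s, rfl⟩
    induction s with
    | zero => simp
    | tmul a b =>
      exact ⟨fun f => by simpa using A.smul_mem _ a.2, fun f => by simpa using B.smul_mem _ b.2⟩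
    | add x y hx hy =>
      simp only [map_add]
      exact ⟨fun f => A.add_mem (hx.1 f) (hy.1 f), fun f => B.add_mem (hx.2 f) (hy.2 f)⟩
  · rintro ⟨hA, hB⟩
    obtain ⟨s, rfl⟩ := mem_range_rTensor_iff.2 hA
    have hs : s ∈ LinearMap.range (B.subtype.lTensor A) := by
      rw [← LinearMap.exact_iff.1
        (lTensor_exact A (LinearMap.exact_subtype_mkQ B) B.mkQ_surjective), LinearMap.mem_ker]
      apply eq_zero_of_sliceLeft
      intro f
      -- A functional on `A` extends to `V`, so slices of `s` are slices of its image in `V ⊗ W`,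
      -- where `hB` applies.
      obtain ⟨g, hg⟩ := f.exists_extend
      have key (s : A ⊗[k] W) : sliceLeft f (B.mkQ.lTensor A s) =
          B.mkQ (sliceLeft g (A.subtype.rTensor W s)) := by
        induction s with
        | zero => simp
        | tmul v w => simp [← hg]
        | add x y hx hy => simp only [map_add, hx, hy]
      rw [key]
      simpa using hB g
    obtain ⟨r, rfl⟩ := hs
    refine ⟨r, ?_⟩
    rw [← LinearMap.comp_apply, LinearMap.rTensor_comp_lTensor]

theorem dual_ext {x y : V} (h : ∀ f : DualAlg k V, f.ofConv x = f.ofConv y) : x = y := by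
  rw [← sub_eq_zero, ← Module.forall_dual_apply_eq_zero_iff k]
  intro f
  rw [map_sub, sub_eq_zero]
  exact h (WithConv.toConv f)

theorem mem_of_forall_dual {N : Submodule k V} {x : V}
    (h : ∀ f : DualAlg k V, (∀ y ∈ N, f.ofConv y = 0) → f.ofConv x = 0) : x ∈ N := by
  by_contra hx
  obtain ⟨f, hf, hN⟩ := Submodule.exists_le_ker_of_notMem hx
  exact hf (h (WithConv.toConv f) fun y hy => hN hy)

end Slices

/-! ### The two commuting actions of the dual algebra -/

section Actions

variable {k C : Type*} [Field k] [AddCommGroup C] [Module k C] [Coalgebra k C]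

/-- The action of `C^*` on the left tensor factor: `lact f c = ∑ f(c₁) c₂`. -/
def lact (f : DualAlg k C) : C →ₗ[k] C :=
  sliceLeft f.ofConv ∘ₗ Coalgebra.comul (R := k) (A := C)

theorem act_eq_sliceRight (f : DualAlg k C) (c : C) :
    act f c = sliceRight f.ofConv (Coalgebra.comul (R := k) c) := rfl

theorem lact_eq_sliceLeft (f : DualAlg k C) (c : C) :
    lact f c = sliceLeft f.ofConv (Coalgebra.comul (R := k) c) := rfl

/-- Together with `apply_lact`, this reduces identities between the actions to identities in the
convolution algebra, tested through `dual_ext`. -/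
theorem apply_act (f g : DualAlg k C) (c : C) : f.ofConv (act g c) = (f * g).ofConv c := by
  have key (t : C ⊗[k] C) : f.ofConv (sliceRight g.ofConv t) =
      LinearMap.mul' k k (TensorProduct.map f.ofConv g.ofConv t) := by
    induction t with
    | zero => simp
    | tmul v w => simp [mul_comm]
    | add x y hx hy => simp [hx, hy]
  exact key _

theorem apply_lact (f g : DualAlg k C) (c : C) : g.ofConv (lact f c) = (f * g).ofConv c := by
  rw [← apply_act]
  exact (apply_sliceRight _ _ _).symm

theorem act_act (f g : DualAlg k C) (c : C) : act f (act g c) = act (f * g) c :=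
  dual_ext (k := k) fun h => by simp only [apply_act, mul_assoc]

theorem lact_lact (f g : DualAlg k C) (c : C) : lact f (lact g c) = lact (g * f) c :=
  dual_ext (k := k) fun h => by simp only [apply_lact, mul_assoc]

theorem act_lact (f g : DualAlg k C) (c : C) : act f (lact g c) = lact g (act f c) :=
  dual_ext (k := k) fun h => by simp only [apply_act, apply_lact, mul_assoc]

theorem act_one (c : C) : act (1 : DualAlg k C) c = c :=
  dual_ext (k := k) fun h => by rw [apply_act, mul_one]

theorem lact_one (c : C) : lact (1 : DualAlg k C) c = c :=
  dual_ext (k := k) fun h => by rw [apply_lact, one_mul]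

/-! ### Subcoalgebras, generated subcoalgebras and closures -/

theorem isSubcomodule_iff {N : Submodule k C} :
    IsSubcomodule C N ↔ ∀ x ∈ N, ∀ f : DualAlg k C, act f x ∈ N := by
  refine forall₂_congr fun x _ => ?_
  rw [mem_range_rTensor_iff]
  exact ⟨fun h f => h f.ofConv, fun h f => h (WithConv.toConv f)⟩

theorem coactsIn_iff {N E : Submodule k C} :
    CoactsIn C N E ↔ ∀ x ∈ N, ∀ f : DualAlg k C, act f x ∈ N ∧ lact f x ∈ E := by
  refine forall₂_congr fun x _ => ?_
  rw [mem_range_map_iff]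
  exact ⟨fun h f => ⟨h.1 f.ofConv, h.2 f.ofConv⟩,
    fun h => ⟨fun f => (h (WithConv.toConv f)).1, fun f => (h (WithConv.toConv f)).2⟩⟩

/-- `rho` is the comultiplication here, so `CoactsIn C D D` is `IsSubcoalgebra D` by definition. -/
theorem isSubcoalgebra_iff {D : Submodule k C} :
    IsSubcoalgebra D ↔ ∀ x ∈ D, ∀ f : DualAlg k C, act f x ∈ D ∧ lact f x ∈ D :=
  coactsIn_iff

theorem IsSubcoalgebra.isSubcomodule {D : Submodule k C} (hD : IsSubcoalgebra D) :
    IsSubcomodule C D :=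
  isSubcomodule_iff.2 fun x hx f => (isSubcoalgebra_iff.1 hD x hx f).1

theorem IsSubcoalgebra.inf {A B : Submodule k C} (hA : IsSubcoalgebra A)
    (hB : IsSubcoalgebra B) : IsSubcoalgebra (A ⊓ B) := by
  rw [isSubcoalgebra_iff] at *
  exact fun x hx f => ⟨⟨(hA x hx.1 f).1, (hB x hx.2 f).1⟩, ⟨(hA x hx.1 f).2, (hB x hx.2 f).2⟩⟩

theorem isSubcoalgebra_bot : IsSubcoalgebra (⊥ : Submodule k C) := by
  rw [isSubcoalgebra_iff]
  rintro x hx f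
  rw [(Submodule.mem_bot k).1 hx]
  simp

theorem isSubcoalgebra_top : IsSubcoalgebra (⊤ : Submodule k C) := by
  rw [isSubcoalgebra_iff]
  simp

theorem isSubcoalgebra_sInf {S : Set (Submodule k C)} (h : ∀ A ∈ S, IsSubcoalgebra A) :
    IsSubcoalgebra (sInf S) := by
  simp only [isSubcoalgebra_iff, Submodule.mem_sInf] at *
  exact fun x hx f => ⟨fun A hA => (h A hA x (hx A hA) f).1, fun A hA => (h A hA x (hx A hA) f).2⟩

theorem isSubcoalgebra_sSup {S : Set (Submodule k C)} (h : ∀ A ∈ S, IsSubcoalgebra A) :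
    IsSubcoalgebra (sSup S) := by
  rw [isSubcoalgebra_iff]
  have h₁ (f : DualAlg k C) : sSup S ≤ (sSup S).comap (act f) := sSup_le fun A hA x hx =>
    le_sSup hA (isSubcoalgebra_iff.1 (h A hA) x hx f).1
  have h₂ (f : DualAlg k C) : sSup S ≤ (sSup S).comap (lact f) := sSup_le fun A hA x hx =>
    le_sSup hA (isSubcoalgebra_iff.1 (h A hA) x hx f).2
  exact fun x hx f => ⟨h₁ f hx, h₂ f hx⟩

theorem IsSubcoalgebra.sup {A B : Submodule k C} (hA : IsSubcoalgebra A)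
    (hB : IsSubcoalgebra B) : IsSubcoalgebra (A ⊔ B) := by
  rw [← sSup_pair]
  apply isSubcoalgebra_sSup
  rintro D (rfl | rfl) <;> assumption

/-- The span of all `∑ g(m₁) m₂` with `m ∈ N`. -/
def lactSpan (N : Submodule k C) : Submodule k C :=
  Submodule.span k {d | ∃ g : DualAlg k C, ∃ m ∈ N, lact g m = d}

theorem lact_mem_lactSpan {N : Submodule k C} (g : DualAlg k C) {m : C} (hm : m ∈ N) :
    lact g m ∈ lactSpan N :=
  Submodule.subset_span ⟨g, m, hm, rfl⟩

theorem le_lactSpan (N : Submodule k C) : N ≤ lactSpan N := fun m hm => by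
  simpa only [lact_one] using lact_mem_lactSpan 1 hm

/-- Stability under `act` is inherited from `N` because the two actions commute; stability under
`lact` is associativity. -/
theorem isSubcoalgebra_lactSpan {N : Submodule k C} (hN : IsSubcomodule C N) :
    IsSubcoalgebra (lactSpan N) := by
  rw [isSubcomodule_iff] at hN
  rw [isSubcoalgebra_iff]
  have h₁ (f : DualAlg k C) : lactSpan N ≤ (lactSpan N).comap (act f) := by
    refine Submodule.span_le.2 ?_
    rintro _ ⟨g, m, hm, rfl⟩
    change act f (lact g m) ∈ lactSpan N
    rw [act_lact]
    exact lact_mem_lactSpan g (hN m hm f)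
  have h₂ (f : DualAlg k C) : lactSpan N ≤ (lactSpan N).comap (lact f) := by
    refine Submodule.span_le.2 ?_
    rintro _ ⟨g, m, hm, rfl⟩
    change lact f (lact g m) ∈ lactSpan N
    rw [lact_lact]
    exact lact_mem_lactSpan _ hm
  exact fun x hx f => ⟨h₁ f hx, h₂ f hx⟩

theorem lactSpan_le {N D : Submodule k C} (hD : IsSubcoalgebra D) (h : N ≤ D) :
    lactSpan N ≤ D := by
  refine Submodule.span_le.2 ?_
  rintro _ ⟨g, m, hm, rfl⟩
  exact (isSubcoalgebra_iff.1 hD m (h hm) g).2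

theorem IsSubcoalgebra.lactSpan_eq {D : Submodule k C} (hD : IsSubcoalgebra D) :
    lactSpan D = D :=
  (lactSpan_le hD le_rfl).antisymm (le_lactSpan D)

open scoped Classical in
theorem coeffSpace_eq_lactSpan {N : Submodule k C} (hN : IsSubcomodule C N) :
    coeffSpace C N = lactSpan N := by
  set b := Module.Basis.ofVectorSpace k N
  have slice (g : DualAlg k C) (m : C) (c : _ →₀ C)
      (hc : rho C m = c.sum fun i e => ((b i : N) : C) ⊗ₜ[k] e) :
      lact g m = c.sum fun i e => g.ofConv (b i : C) • e := by
    have : lact g m = sliceLeft g.ofConv (rho C m) := rfl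
    rw [this, hc, Finsupp.sum, map_sum]
    simp [Finsupp.sum]
  apply le_antisymm
  · refine Submodule.span_le.2 ?_
    rintro _ ⟨m, hm, c, hc, i, rfl⟩
    -- An extension of the `i`-th coordinate functional to all of `C` extracts exactly the
    -- coefficient `c i`.
    obtain ⟨g, hg⟩ := (b.coord i).exists_extend
    have hgi (j) : g (b j : C) = if j = i then 1 else 0 := by
      have := LinearMap.congr_fun hg (b j)
      simpa [Finsupp.single_apply] using this
    have : lact (WithConv.toConv g) m = c i := by
      rw [slice _ m c hc]
      simp [hgi, Finsupp.sum, eq_comm]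
    rw [← this]
    exact lact_mem_lactSpan _ hm
  · refine Submodule.span_le.2 ?_
    rintro _ ⟨g, m, hm, rfl⟩
    obtain ⟨t, ht⟩ := hN m hm
    obtain ⟨c, rfl⟩ := TensorProduct.eq_repr_basis_left b t
    have hc : rho C m = c.sum fun i e => ((b i : N) : C) ⊗ₜ[k] e := by
      rw [← ht, Finsupp.sum, map_sum]
      simp [Finsupp.sum]
    rw [slice g m c hc]
    exact Submodule.sum_mem _ fun i _ =>
      Submodule.smul_mem _ _ (Submodule.subset_span ⟨m, hm, c, hc, i, rfl⟩)

/-- Both sides say that `(g * f)(m) = 0` for all `g` and all `m ∈ N`. -/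
theorem mem_annDual_iff {N : Submodule k C} {f : DualAlg k C} :
    f ∈ annDual C N ↔ ∀ x ∈ lactSpan N, f.ofConv x = 0 := by
  constructor
  · intro hf
    have : lactSpan N ≤ LinearMap.ker f.ofConv := by
      refine Submodule.span_le.2 ?_
      rintro _ ⟨g, m, hm, rfl⟩
      change f.ofConv (lact g m) = 0
      rw [apply_lact, ← apply_act, hf m hm, map_zero]
    exact this
  · intro h x hx
    refine dual_ext (k := k) fun g => ?_
    rw [apply_act, ← apply_lact, h _ (lact_mem_lactSpan g hx), map_zero]

theorem IsSubcoalgebra.mem_annDual_iff {D : Submodule k C} (hD : IsSubcoalgebra D)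
    {f : DualAlg k C} : f ∈ annDual C D ↔ ∀ x ∈ D, f.ofConv x = 0 := by
  rw [ComoduleDecomp.mem_annDual_iff, hD.lactSpan_eq]

theorem counit_act (f : DualAlg k C) (c : C) :
    Coalgebra.counit (R := k) (act f c) = f.ofConv c := by
  have := apply_act 1 f c
  rwa [one_mul] at this

/-- A functional vanishing on `lactSpan N` annihilates `N`, hence kills `x` under `act`, and the
counit turns this into `f x = 0`; functionals separate points from subspaces. -/
theorem closureM_eq_lactSpan {N : Submodule k C} (hN : IsSubcomodule C N) :
    closureM C N = lactSpan N := by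
  ext x
  constructor
  · intro hx
    refine mem_of_forall_dual fun f hf => ?_
    rw [← counit_act, hx f (mem_annDual_iff.2 hf), map_zero]
  · intro hx f hf
    refine dual_ext (k := k) fun g => ?_
    rw [apply_act, ← apply_lact, map_zero]
    exact mem_annDual_iff.1 hf _ (isSubcoalgebra_iff.1 (isSubcoalgebra_lactSpan hN) x hx g).2

theorem isClosedSubcomodule_iff {N : Submodule k C} :
    IsClosedSubcomodule C N ↔ IsSubcoalgebra N := by
  constructor
  · rintro ⟨h, hc⟩
    rw [← hc, closureM_eq_lactSpan h]
    exact isSubcoalgebra_lactSpan h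
  · intro h
    exact ⟨h.isSubcomodule, by rw [closureM_eq_lactSpan h.isSubcomodule, h.lactSpan_eq]⟩

theorem isSubcomodule_orbit (x : C) : IsSubcomodule C (orbit (k := k) C x) := by
  rw [isSubcomodule_iff]
  intro y hy f
  have : orbit (k := k) C x ≤ (orbit C x).comap (act f) := by
    refine Submodule.span_le.2 ?_
    rintro _ ⟨g, rfl⟩
    refine Submodule.subset_span ⟨f * g, ?_⟩
    exact (act_act f g x).symm
  exact this hy

theorem mem_orbit (x : C) : x ∈ orbit (k := k) C x :=
  Submodule.subset_span ⟨1, act_one x⟩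

theorem IsSubcoalgebra.closureM_orbit_le {D : Submodule k C} (hD : IsSubcoalgebra D) {x : C}
    (hx : x ∈ D) : closureM C (orbit (k := k) C x) ≤ D := by
  rw [closureM_eq_lactSpan (isSubcomodule_orbit x)]
  refine lactSpan_le hD (Submodule.span_le.2 ?_)
  rintro _ ⟨g, rfl⟩
  exact (isSubcoalgebra_iff.1 hD x hx g).1

theorem isWeakClosedSubcomodule_iff {N : Submodule k C} :
    IsWeakClosedSubcomodule C N ↔ IsSubcoalgebra N := by
  constructor
  · rintro ⟨hN, h⟩
    rw [isSubcoalgebra_iff]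
    intro x hx f
    refine ⟨isSubcomodule_iff.1 hN x hx f, h x hx ?_⟩
    rw [closureM_eq_lactSpan (isSubcomodule_orbit x)]
    exact lact_mem_lactSpan f (mem_orbit x)
  · exact fun h => ⟨h.isSubcomodule, fun x hx => h.closureM_orbit_le hx⟩

theorem isMinimalClosedSubcomodule_iff {N : Submodule k C} :
    IsMinimalClosedSubcomodule C N ↔ IsSimpleSubcoalgebra N := by
  simp only [IsMinimalClosedSubcomodule, IsSimpleSubcoalgebra, isClosedSubcomodule_iff]

/-! ### Components, wedges and the comparison of notions -/

theorem perpC_eq_perpM (X : Ideal (DualAlg k C)) :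
    perpC (X : Set (DualAlg k C)) = perpM (M := C) (X : Set (DualAlg k C)) := by
  ext c
  constructor
  · intro hc f hf
    refine dual_ext (k := k) fun g => ?_
    rw [apply_act, map_zero]
    exact hc _ (X.mul_mem_left g hf)
  · intro hc f hf
    rw [← counit_act, hc f hf, map_zero]

theorem component_eq {F : Submodule k C} (hF : IsSubcoalgebra F) : component C F = F := by
  apply le_antisymm
  · refine sSup_le ?_
    rintro N ⟨-, hN⟩ x hx
    simpa only [lact_one] using (coactsIn_iff.1 hN x hx 1).2
  · exact le_sSup ⟨hF.isSubcomodule, hF⟩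

/-- Functionals on `C/X` and `C/Y` are those on `C` vanishing on `X` and `Y`, and their products
separate the points of `C/X ⊗ C/Y`. -/
theorem mem_wedgeC_iff {X Y : Submodule k C} {c : C} :
    c ∈ wedgeC X Y ↔ ∀ f g : DualAlg k C, (∀ x ∈ X, f.ofConv x = 0) →
      (∀ y ∈ Y, g.ofConv y = 0) → (f * g).ofConv c = 0 := by
  have key (f : C ⧸ X →ₗ[k] k) (g : C ⧸ Y →ₗ[k] k) (t : C ⊗[k] C) :
      f (sliceRight g (TensorProduct.map X.mkQ Y.mkQ t)) =
        (f ∘ₗ X.mkQ) (sliceRight (g ∘ₗ Y.mkQ) t) := by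
    induction t with
    | zero => simp
    | tmul v w => simp
    | add x y hx hy => simp only [map_add, hx, hy]
  have key' (f : C ⧸ X →ₗ[k] k) (g : C ⧸ Y →ₗ[k] k) :
      f (sliceRight g (TensorProduct.map X.mkQ Y.mkQ (Coalgebra.comul (R := k) c))) =
        (WithConv.toConv (f ∘ₗ X.mkQ) * WithConv.toConv (g ∘ₗ Y.mkQ) : DualAlg k C).ofConv c := by
    rw [key, ← apply_act]
    rfl
  constructor
  · intro hc f g hf hg
    have hc' : TensorProduct.map X.mkQ Y.mkQ (Coalgebra.comul (R := k) c) = 0 := hc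
    have := key' (X.liftQ f.ofConv hf) (Y.liftQ g.ofConv hg)
    rw [hc', map_zero, map_zero] at this
    exact this.symm
  · intro h
    change TensorProduct.map X.mkQ Y.mkQ (Coalgebra.comul (R := k) c) = 0
    refine eq_zero_of_sliceRight fun g => ?_
    rw [← Module.forall_dual_apply_eq_zero_iff k]
    intro f
    rw [key']
    exact h _ _ (fun x hx => by simp [(Submodule.Quotient.mk_eq_zero X).2 hx])
      (fun y hy => by simp [(Submodule.Quotient.mk_eq_zero Y).2 hy])

theorem wedgeM_eq_wedgeC {N L : Submodule k C} (hN : IsSubcoalgebra N) (hL : IsSubcoalgebra L) :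
    wedgeM C N L = wedgeC N L := by
  ext c
  rw [mem_wedgeC_iff]
  constructor
  · intro hc f g hf hg
    rw [← counit_act, hc _ ⟨f, hN.mem_annDual_iff.2 hf, g, hL.mem_annDual_iff.2 hg, rfl⟩, map_zero]
  · rintro h _ ⟨f, hf, g, hg, rfl⟩
    refine dual_ext (k := k) fun e => ?_
    rw [apply_act, map_zero, ← mul_assoc]
    -- The test functional `e` is absorbed on the left: `e * f` still vanishes on `N`.
    refine h _ _ (fun x hx => ?_) (hL.mem_annDual_iff.1 hg)
    rw [← apply_act, hf x hx, map_zero]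

theorem linkedM_of_linkedC {D E : Submodule k C} (h : LinkedC D E) : LinkedM C D E := by
  obtain ⟨hD, hE, h⟩ := h
  refine ⟨isMinimalClosedSubcomodule_iff.2 hD, isMinimalClosedSubcomodule_iff.2 hE, ?_⟩
  simp only [isMinimalClosedSubcomodule_iff]
  intro M₁ M₂ hu hi hDM hEM
  obtain ⟨D₁, hD₁, E₁, hE₁, hne⟩ := h M₁ M₂ hu hi hDM hEM
  have hD' : IsSubcoalgebra D₁ := (hu.subset (Or.inl hD₁)).1
  have hE' : IsSubcoalgebra E₁ := (hu.subset (Or.inr hE₁)).1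
  refine ⟨D₁, hD₁, E₁, hE₁, ?_⟩
  rwa [wedgeM_eq_wedgeC hD' hE', wedgeM_eq_wedgeC hE' hD']

theorem isFull_regular : IsFull k C C := by
  rw [IsFull, coeffSpace_eq_lactSpan isSubcoalgebra_top.isSubcomodule,
    isSubcoalgebra_top.lactSpan_eq]

theorem isWRelationalHereditary_regular : IsWRelationalHereditary k C C := by
  intro D E hD hE _ _ h
  rw [component_eq hD.1, component_eq hE.1]
  exact linkedM_of_linkedC h

theorem isComponentFaithful_regular : IsComponentFaithful k C C := by
  intro D hD
  rw [component_eq hD.1]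
  exact ne_or_eq D ⊥

/-- Closures of elements of a subcoalgebra `N` stay in `N`, so intersecting them with `N` changes
nothing. -/
theorem isDecomposableSubcomodule_iff {N : Submodule k C} (hN : IsSubcoalgebra N) :
    IsDecomposableSubcomodule C N ↔ IsDecomposableSubcoalgebra N := by
  have key {P : Submodule k C} (hP : P ≤ N) : IsWeakClosedIn C N P ↔ IsSubcoalgebra P := by
    rw [← isWeakClosedSubcomodule_iff]
    constructor
    · rintro ⟨h₁, -, h⟩
      exact ⟨h₁, fun x hx => (le_inf le_rfl (hN.closureM_orbit_le (hP hx))).trans (h x hx)⟩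
    · rintro ⟨h₁, h⟩
      exact ⟨h₁, hP, fun x hx => inf_le_left.trans (h x hx)⟩
  constructor
  · rintro ⟨P, Q, hP, hQ, h⟩
    exact ⟨P, Q, (key hP.2.1).1 hP, (key hQ.2.1).1 hQ, h⟩
  · rintro ⟨P, Q, hP, hQ, h⟩
    have hPN : P ≤ N := le_sup_left.trans_eq h.2.2.2
    have hQN : Q ≤ N := le_sup_right.trans_eq h.2.2.2
    exact ⟨P, Q, (key hPN).2 hP, (key hQN).2 hQ, h⟩

theorem isWeakClosedIndecDecomposition_iff {S : Set (Submodule k C)} :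
    IsWeakClosedIndecDecomposition C S ↔ IsIndecDecompositionC S := by
  refine and_congr_right fun _ => and_congr_right fun _ => forall₂_congr fun N _ => ?_
  rw [isWeakClosedSubcomodule_iff]
  exact and_congr_right fun hN => by rw [isDecomposableSubcomodule_iff hN]

end Actions

end ComoduleDecomp

/-! ### Local finiteness and split subcoalgebras -/

namespace ComoduleDecomp

variable {k C : Type*} [Field k] [AddCommGroup C] [Module k C] [Coalgebra k C]

/-- The first tensor factors of `Δ x` span a space containing the orbit of `x`; the second tensor
factors of `Δ` on a finite basis of that orbit span one containing the subcoalgebra it generates. -/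
theorem exists_finiteDimensional_subcoalgebra (x : C) :
    ∃ F : Submodule k C, IsSubcoalgebra F ∧ FiniteDimensional k F ∧ x ∈ F := by
  have fin_act (y : C) : ∃ G : Submodule k C, FiniteDimensional k G ∧
      ∀ f : DualAlg k C, act f y ∈ G := by
    obtain ⟨s, hs⟩ := TensorProduct.exists_finset (R := k) (Coalgebra.comul (R := k) y)
    refine ⟨Submodule.span k (Prod.fst '' (s : Set (C × C))),
      FiniteDimensional.span_of_finite k (s.finite_toSet.image _), fun f => ?_⟩
    rw [act_eq_sliceRight, hs, map_sum]
    refine Submodule.sum_mem _ fun i hi => ?_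
    rw [sliceRight_tmul]
    exact Submodule.smul_mem _ _ (Submodule.subset_span ⟨i, hi, rfl⟩)
  have fin_lact (y : C) : ∃ G : Submodule k C, FiniteDimensional k G ∧
      ∀ f : DualAlg k C, lact f y ∈ G := by
    obtain ⟨s, hs⟩ := TensorProduct.exists_finset (R := k) (Coalgebra.comul (R := k) y)
    refine ⟨Submodule.span k (Prod.snd '' (s : Set (C × C))),
      FiniteDimensional.span_of_finite k (s.finite_toSet.image _), fun f => ?_⟩
    rw [lact_eq_sliceLeft, hs, map_sum]
    refine Submodule.sum_mem _ fun i hi => ?_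
    rw [sliceLeft_tmul]
    exact Submodule.smul_mem _ _ (Submodule.subset_span ⟨i, hi, rfl⟩)
  have hsub := isSubcoalgebra_lactSpan (isSubcomodule_orbit (k := k) x)
  refine ⟨lactSpan (orbit (k := k) C x), hsub, ?_, le_lactSpan _ (mem_orbit x)⟩
  obtain ⟨G, hG, hGx⟩ := fin_act x
  have horb : orbit (k := k) C x ≤ G := by
    refine Submodule.span_le.2 ?_
    rintro _ ⟨f, rfl⟩
    exact hGx f
  have : FiniteDimensional k (orbit (k := k) C x) := Submodule.finiteDimensional_of_le horb
  let b := Module.finBasis k (orbit (k := k) C x)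
  choose H hH hHx using fun i => fin_lact (b i : C)
  have : FiniteDimensional k (⨆ i, H i : Submodule k C) := Submodule.finiteDimensional_iSup H
  refine Submodule.finiteDimensional_of_le (S₂ := ⨆ i, H i) (Submodule.span_le.2 ?_)
  rintro _ ⟨g, m, hm, rfl⟩
  have hm' := congrArg Subtype.val (b.sum_repr ⟨m, hm⟩)
  rw [← show _ = m from hm']
  simp only [AddSubmonoidClass.coe_finsetSum, Submodule.coe_smul, map_sum, map_smul]
  exact Submodule.sum_mem _ fun i _ =>
    Submodule.smul_mem _ _ (le_iSup H i (hHx i g))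

/-- A subcoalgebra is compatible with every decomposition of `C` into two subcoalgebras. -/
theorem IsSubcoalgebra.le_sup_inf {A B D : Submodule k C} (hD : IsSubcoalgebra D)
    (hA : IsSubcoalgebra A) (hB : IsSubcoalgebra B) (h : IsCompl A B) :
    D ≤ D ⊓ A ⊔ D ⊓ B := by
  -- The functional that is the counit on `A` and zero on `B` acts as the projection onto `A` along
  -- `B`, and `D` is stable under it.
  let e : DualAlg k C := WithConv.toConv
    (LinearMap.ofIsCompl h ((1 : DualAlg k C).ofConv ∘ₗ A.subtype) 0)
  have heA (a : C) (ha : a ∈ A) : e.ofConv a = (1 : DualAlg k C).ofConv a :=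
    LinearMap.ofIsCompl_apply_left h ⟨a, ha⟩
  have heB (b : C) (hb : b ∈ B) : e.ofConv b = 0 :=
    LinearMap.ofIsCompl_apply_right h ⟨b, hb⟩
  intro d hd
  obtain ⟨a, ha, b, hb, rfl⟩ := Submodule.mem_sup.1
    (h.sup_eq_top.symm ▸ Submodule.mem_top : d ∈ A ⊔ B)
  have h₁ : act e a = a := by
    refine dual_ext (k := k) fun f => ?_
    rw [apply_act, ← apply_lact, heA _ (isSubcoalgebra_iff.1 hA a ha f).2, apply_lact, mul_one]
  have h₂ : act e b = 0 := by
    refine dual_ext (k := k) fun f => ?_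
    rw [apply_act, ← apply_lact, heB _ (isSubcoalgebra_iff.1 hB b hb f).2, map_zero]
  have haD : a ∈ D := by
    have := (isSubcoalgebra_iff.1 hD _ hd e).1
    rwa [map_add, h₁, h₂, add_zero] at this
  have hbD : b ∈ D := by simpa using D.sub_mem hd haD
  exact Submodule.add_mem_sup ⟨haD, ha⟩ ⟨hbD, hb⟩

theorem IsSubcoalgebra.le_of_disjoint {A B D : Submodule k C} (hD : IsSubcoalgebra D)
    (hA : IsSubcoalgebra A) (hB : IsSubcoalgebra B) (h : IsCompl A B) (hDA : Disjoint D A) :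
    D ≤ B := by
  have := hD.le_sup_inf hA hB h
  rw [hDA.eq_bot, bot_sup_eq] at this
  exact this.trans inf_le_right

/-- The lattice of subspaces is only modular; `le_sup_inf` provides the distributivity for these
subcoalgebras. -/
theorem isCompl_inf_sup {A₁ B₁ A₂ B₂ : Submodule k C} (hA₁ : IsSubcoalgebra A₁)
    (hB₁ : IsSubcoalgebra B₁) (hA₂ : IsSubcoalgebra A₂) (hB₂ : IsSubcoalgebra B₂)
    (h₁ : IsCompl A₁ B₁) (h₂ : IsCompl A₂ B₂) : IsCompl (A₁ ⊓ A₂) (B₁ ⊔ B₂) := by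
  constructor
  · rw [disjoint_iff]
    have hle : B₁ ⊔ B₂ ≤ B₂ ⊓ A₁ ⊔ B₁ := sup_le le_sup_right
      ((hB₂.le_sup_inf hA₁ hB₁ h₁).trans (sup_le_sup_left inf_le_right _))
    have hmod : (B₂ ⊓ A₁ ⊔ B₁) ⊓ A₁ = B₂ ⊓ A₁ := by
      rw [sup_inf_assoc_of_le _ inf_le_right, inf_comm B₁ A₁, h₁.inf_eq_bot, sup_bot_eq]
    have h3 : (B₁ ⊔ B₂) ⊓ A₁ ≤ B₂ := (inf_le_inf_right _ hle).trans (hmod.le.trans inf_le_left)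
    rw [eq_bot_iff, ← h₂.inf_eq_bot]
    exact le_inf (inf_le_left.trans inf_le_right)
      ((le_inf inf_le_right (inf_le_left.trans inf_le_left)).trans h3)
  · rw [codisjoint_iff, eq_top_iff, ← h₁.sup_eq_top]
    refine sup_le ((hA₁.le_sup_inf hA₂ hB₂ h₂).trans (sup_le le_sup_left ?_))
      (le_sup_left.trans le_sup_right)
    exact inf_le_right.trans (le_sup_right.trans le_sup_right)

/-- Subcoalgebras that are direct summands of `C` with a subcoalgebra as complement. -/
def IsSplit (A : Submodule k C) : Prop :=
  IsSubcoalgebra A ∧ ∃ B, IsSubcoalgebra B ∧ IsCompl A B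

/-- The non-zero indecomposable split subcoalgebras. -/
def IsBlock (P : Submodule k C) : Prop :=
  IsSplit P ∧ P ≠ ⊥ ∧ ¬ IsDecomposableSubcoalgebra P

-- Choose `A` minimising `dim (F ⊓ A)`: cutting further by `A'` cannot shrink `F ⊓ A`.
omit [Coalgebra k C] in
theorem exists_inf_minimal {S : Set (Submodule k C)} (hne : S.Nonempty) (hS : InfClosed S)
    (F : Submodule k C) [FiniteDimensional k F] : ∃ A ∈ S, ∀ A' ∈ S, F ⊓ A ≤ A' := by
  obtain ⟨A, hA, hmin⟩ := exists_minimalFor_of_wellFoundedLT (· ∈ S)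
    (fun A => Module.finrank k (F ⊓ A : Submodule k C)) hne
  refine ⟨A, hA, fun A' hA' => ?_⟩
  have hle : F ⊓ (A ⊓ A') ≤ F ⊓ A := inf_le_inf_left _ inf_le_left
  have hfd : FiniteDimensional k (F ⊓ A : Submodule k C) :=
    Submodule.finiteDimensional_of_le inf_le_left
  have := Submodule.eq_of_le_of_finrank_le hle
    (hmin (hS hA hA') (Submodule.finrank_mono hle))
  rw [← this]
  exact inf_le_right.trans inf_le_right

/-- The complement is the directed union of the complements of members of `S`. It is large enough
because on a finite-dimensional subcoalgebra `F` a single member of `S` already cuts out `F ⊓ sInf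
S`. -/
theorem isSplit_sInf {S : Set (Submodule k C)} (hne : S.Nonempty) (hS : InfClosed S)
    (hsplit : ∀ A ∈ S, IsSplit A) : IsSplit (sInf S) := by
  set T : Set (Submodule k C) := {B | IsSubcoalgebra B ∧ ∃ A ∈ S, IsCompl A B}
  refine ⟨isSubcoalgebra_sInf fun A hA => (hsplit A hA).1, sSup T,
    isSubcoalgebra_sSup fun B hB => hB.1, ?_, ?_⟩
  · have hTne : T.Nonempty := by
      obtain ⟨A, hA⟩ := hne
      obtain ⟨-, B, hB, hAB⟩ := hsplit A hA
      exact ⟨B, hB, A, hA, hAB⟩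
    have hdir : DirectedOn (· ≤ ·) T := by
      rintro B₁ ⟨hB₁, A₁, hA₁, h₁⟩ B₂ ⟨hB₂, A₂, hA₂, h₂⟩
      exact ⟨B₁ ⊔ B₂, ⟨hB₁.sup hB₂, A₁ ⊓ A₂, hS hA₁ hA₂, isCompl_inf_sup (hsplit _ hA₁).1 hB₁
        (hsplit _ hA₂).1 hB₂ h₁ h₂⟩, le_sup_left, le_sup_right⟩
    rw [Submodule.disjoint_def]
    intro x hx hxT
    obtain ⟨B, ⟨-, A, hA, hAB⟩, hxB⟩ := (Submodule.mem_sSup_of_directed hTne hdir).1 hxT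
    exact Submodule.disjoint_def.1 hAB.disjoint x (Submodule.mem_sInf.1 hx A hA) hxB
  · rw [codisjoint_iff, eq_top_iff]
    intro x _
    obtain ⟨F, hF, hfin, hxF⟩ := exists_finiteDimensional_subcoalgebra (k := k) x
    obtain ⟨A, hA, hmin⟩ := exists_inf_minimal hne hS F
    obtain ⟨hAs, B, hB, hAB⟩ := hsplit A hA
    have hBT : B ∈ T := ⟨hB, A, hA, hAB⟩
    exact sup_le_sup (le_sInf hmin) (inf_le_right.trans (le_sSup hBT))
      (hF.le_sup_inf hAs hB hAB hxF)

/-! ### Simple subcoalgebras and blocks -/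

theorem exists_simple_le {G : Submodule k C} (hG : IsSubcoalgebra G) [FiniteDimensional k G]
    (hne : G ≠ ⊥) : ∃ D ≤ G, IsSimpleSubcoalgebra D ∧ D ≠ ⊥ := by
  have hex : ∃ D : Submodule k C, IsSubcoalgebra D ∧ D ≠ ⊥ ∧ D ≤ G := ⟨G, hG, hne, le_rfl⟩
  obtain ⟨D, ⟨hD, hD0, hDG⟩, hmin⟩ := exists_minimalFor_of_wellFoundedLT _
    (fun D : Submodule k C => Module.finrank k D) hex
  have : FiniteDimensional k D := Submodule.finiteDimensional_of_le hDG
  exact ⟨D, hDG, ⟨hD, fun F hF hFD hF0 => Submodule.eq_of_le_of_finrank_le hFD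
    (hmin ⟨hF, hF0, hFD.trans hDG⟩ (Submodule.finrank_mono hFD))⟩, hD0⟩

theorem IsSimpleSubcoalgebra.le_or_le {A B D : Submodule k C} (hD : IsSimpleSubcoalgebra D)
    (hA : IsSubcoalgebra A) (hB : IsSubcoalgebra B) (h : IsCompl A B) : D ≤ A ∨ D ≤ B := by
  by_cases h0 : D ⊓ A = ⊥
  · exact Or.inr (hD.1.le_of_disjoint hA hB h (disjoint_iff.2 h0))
  · exact Or.inl (inf_eq_left.1 (hD.2 _ (hD.1.inf hA) inf_le_left h0))

theorem isCompl_sup_of_isCompl {P P' A B : Submodule k C} (hP' : IsSubcoalgebra P')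
    (hPP' : IsCompl P P') (hB : IsSubcoalgebra B)
    (hd : Disjoint A B) (hAB : A ⊔ B = P) : IsSubcoalgebra (B ⊔ P') ∧ IsCompl A (B ⊔ P') := by
  subst hAB
  refine ⟨hB.sup hP', hd.disjoint_sup_right_of_disjoint_sup_left hPP'.disjoint, ?_⟩
  rw [codisjoint_iff, ← sup_assoc, hPP'.sup_eq_top]

/-- The block is the least split subcoalgebra containing `D`. If it were `A ⊕ B`, simplicity would
place `D` in one summand, itself split, against minimality. -/
theorem exists_block_ge {D : Submodule k C} (hD : IsSimpleSubcoalgebra D) (hD0 : D ≠ ⊥) :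
    ∃ P, IsBlock P ∧ D ≤ P := by
  set S : Set (Submodule k C) := {A | IsSplit A ∧ D ≤ A}
  have hne : S.Nonempty :=
    ⟨⊤, ⟨isSubcoalgebra_top, ⊥, isSubcoalgebra_bot, isCompl_top_bot⟩, le_top⟩
  have hinf : InfClosed S := by
    rintro A₁ ⟨⟨hA₁, B₁, hB₁, h₁⟩, hl₁⟩ A₂ ⟨⟨hA₂, B₂, hB₂, h₂⟩, hl₂⟩
    exact ⟨⟨hA₁.inf hA₂, B₁ ⊔ B₂, hB₁.sup hB₂, isCompl_inf_sup hA₁ hB₁ hA₂ hB₂ h₁ h₂⟩,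
      le_inf hl₁ hl₂⟩
  have hDP : D ≤ sInf S := le_sInf fun A hA => hA.2
  have hsplit : IsSplit (sInf S) := isSplit_sInf hne hinf fun A hA => hA.1
  refine ⟨sInf S, ⟨hsplit, ne_bot_of_le_ne_bot hD0 hDP, ?_⟩, hDP⟩
  obtain ⟨-, P', hP', hPP'⟩ := hsplit
  have key {A B : Submodule k C} (hA : IsSubcoalgebra A) (hB : IsSubcoalgebra B) (hB0 : B ≠ ⊥)
      (hd : Disjoint A B) (hAB : A ⊔ B = sInf S) : ¬ D ≤ A := by
    intro hDA
    obtain ⟨h₁, h₂⟩ := isCompl_sup_of_isCompl hP' hPP' hB hd hAB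
    have : sInf S ≤ A := sInf_le ⟨⟨hA, _, h₁, h₂⟩, hDA⟩
    exact hB0 (disjoint_self.1 (hd.mono_left ((le_sup_right.trans_eq hAB).trans this)))
  rintro ⟨A, B, hA, hB, hA0, hB0, hd, hAB⟩
  obtain ⟨h₁, h₂⟩ := isCompl_sup_of_isCompl hP' hPP' hB hd hAB
  rcases hD.le_or_le hA h₁ h₂ with h | h
  · exact key hA hB hB0 hd hAB h
  · obtain ⟨h₃, h₄⟩ := isCompl_sup_of_isCompl hP' hPP' hA hd.symm (by rw [sup_comm, hAB])
    rcases hD.le_or_le hB h₃ h₄ with h' | h'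
    · exact key hB hA hA0 hd.symm (by rw [sup_comm, hAB]) h'
    -- Here `D` avoids both summands, so it lies in `(B ⊔ P') ⊓ (A ⊔ P')`, a complement of `A ⊔ B =
    -- sInf S`, which also contains `D`.
    · refine hD0 (eq_bot_iff.2 ?_)
      have hDAP : D ≤ (B ⊔ P') ⊓ (A ⊔ P') := le_inf h h'
      have hcomp := isCompl_inf_sup h₁ hA h₃ hB h₂.symm h₄.symm
      rw [hAB] at hcomp
      exact (le_inf hDAP hDP).trans hcomp.inf_eq_bot.le

/-- `P` splits along `Q` and its complement `R`, so by indecomposability one of the two pieces is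
zero. -/
theorem IsBlock.eq_or_disjoint {P Q : Submodule k C} (hP : IsBlock P) (hQ : IsBlock Q) :
    P = Q ∨ Disjoint P Q := by
  have key {P Q : Submodule k C} (hP : IsBlock P) (hQ : IsBlock Q) : P ≤ Q ∨ Disjoint P Q := by
    obtain ⟨⟨hPs, -⟩, -, hPi⟩ := hP
    obtain ⟨⟨hQs, R, hR, hQR⟩, -⟩ := hQ
    by_contra! hcon
    refine hPi ⟨P ⊓ Q, P ⊓ R, hPs.inf hQs, hPs.inf hR, fun h => hcon.2 (disjoint_iff.2 h),
      fun h => hcon.1 ?_, hQR.disjoint.mono inf_le_right inf_le_right,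
      (sup_le inf_le_left inf_le_left).antisymm (hPs.le_sup_inf hQs hR hQR)⟩
    exact hPs.le_of_disjoint hR hQs hQR.symm (disjoint_iff.2 h)
  rcases key hP hQ with h | h
  · rcases key hQ hP with h' | h'
    · exact Or.inl (h.antisymm h')
    · exact Or.inr h'.symm
  · exact Or.inr h

theorem sSup_blocks : sSup {P : Submodule k C | IsBlock P} = ⊤ := by
  set T := sSup {P : Submodule k C | IsBlock P}
  rw [eq_top_iff]
  intro x _
  obtain ⟨F, hF, hfin, hxF⟩ := exists_finiteDimensional_subcoalgebra (k := k) x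
  -- `S` collects the split subcoalgebras having a complement inside `T`. For `A ∈ S` with least
  -- trace on `F`, a non-zero `F ⊓ A` would contain a simple `D` in some block `P`; the complement
  -- `R` of `P` is in `S`, forcing `D ≤ R` as well.
  set S : Set (Submodule k C) :=
    {A | IsSubcoalgebra A ∧ ∃ B, IsSubcoalgebra B ∧ IsCompl A B ∧ B ≤ T}
  have hne : S.Nonempty :=
    ⟨⊤, isSubcoalgebra_top, ⊥, isSubcoalgebra_bot, isCompl_top_bot, bot_le⟩
  have hinf : InfClosed S := by
    rintro A₁ ⟨hA₁, B₁, hB₁, h₁, hl₁⟩ A₂ ⟨hA₂, B₂, hB₂, h₂, hl₂⟩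
    exact ⟨hA₁.inf hA₂, B₁ ⊔ B₂, hB₁.sup hB₂, isCompl_inf_sup hA₁ hB₁ hA₂ hB₂ h₁ h₂,
      sup_le hl₁ hl₂⟩
  obtain ⟨A, ⟨hA, B, hB, hAB, hBT⟩, hmin⟩ := exists_inf_minimal hne hinf F
  have h0 : F ⊓ A = ⊥ := by
    by_contra hFA
    have : FiniteDimensional k (F ⊓ A : Submodule k C) :=
      Submodule.finiteDimensional_of_le inf_le_left
    obtain ⟨D, hDF, hD, hD0⟩ := exists_simple_le (hF.inf hA) hFA
    obtain ⟨P, hP, hDP⟩ := exists_block_ge hD hD0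
    obtain ⟨hPs, R, hR, hPR⟩ := hP.1
    have hDR : D ≤ R := hDF.trans (hmin R ⟨hR, P, hPs, hPR.symm, le_sSup hP⟩)
    exact hD0 (eq_bot_iff.2 ((le_inf hDP hDR).trans hPR.inf_eq_bot.le))
  exact hBT (hF.le_of_disjoint hA hB hAB (disjoint_iff.2 h0) hxF)

theorem isIndecDecompositionC_iff {S : Set (Submodule k C)} :
    IsIndecDecompositionC S ↔ S = {P | IsBlock P} := by
  constructor
  · rintro ⟨hind, htop, hS⟩
    have hsub : S ⊆ {P | IsBlock P} := by
      intro D hD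
      refine ⟨⟨(hS D hD).1, sSup (S \ {D}), isSubcoalgebra_sSup fun A hA => (hS A hA.1).1,
        hind hD, ?_⟩, (hS D hD).2⟩
      rw [codisjoint_iff, eq_top_iff, ← htop]
      refine sSup_le fun A hA => ?_
      by_cases hAD : A = D
      · exact hAD ▸ le_sup_left
      · exact (le_sSup ⟨hA, hAD⟩ : A ≤ sSup (S \ {D})).trans le_sup_right
    -- A block `P` missing from `S` is disjoint from every member, so all members lie in the
    -- complement `R` of `P`, making `R` everything.
    refine hsub.antisymm fun P hP => ?_
    by_contra hPS
    obtain ⟨hPs, R, hR, hPR⟩ := hP.1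
    have hle : ⊤ ≤ R := by
      rw [← htop]
      refine sSup_le fun D hD => (hS D hD).1.le_of_disjoint hPs hR hPR ?_
      rcases (hsub hD).eq_or_disjoint hP with h | h
      · exact absurd (h ▸ hD) hPS
      · exact h
    exact hP.2.1 (disjoint_self.1 (hPR.disjoint.mono_right (le_top.trans hle)))
  · rintro rfl
    refine ⟨fun P hP => ?_, sSup_blocks, fun P hP => ⟨hP.1.1, hP.2⟩⟩
    obtain ⟨hPs, R, hR, hPR⟩ := hP.1
    -- Every other block is disjoint from `P`, hence inside the one complement `R`; pairwise
    -- disjointness thus upgrades to independence.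
    refine hPR.disjoint.mono_right (sSup_le fun Q hQ => ?_)
    refine hQ.1.1.1.le_of_disjoint hPs hR hPR ?_
    exact (hQ.1.eq_or_disjoint hP).resolve_left hQ.2

end ComoduleDecomp

theorem proposition1p17 (k C : Type*) [Field k] [AddCommGroup C] [Module k C] [Coalgebra k C] :
    -- (1)
    (∀ X : Ideal (ComoduleDecomp.DualAlg k C), X.IsTwoSided →
      ComoduleDecomp.perpC (X : Set (ComoduleDecomp.DualAlg k C)) =
        ComoduleDecomp.perpM (M := C) (X : Set (ComoduleDecomp.DualAlg k C))) ∧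
    (∀ N : Submodule k C, ComoduleDecomp.IsSubcomodule C N →
      ComoduleDecomp.closureM C N = ComoduleDecomp.coeffSpace C N) ∧
    (∀ F : Submodule k C, ComoduleDecomp.IsSubcoalgebra F →
      ComoduleDecomp.coeffSpace C (ComoduleDecomp.component C F) = F) ∧
    -- (2)
    (∀ N : Submodule k C,
      ComoduleDecomp.IsClosedSubcomodule C N ↔ ComoduleDecomp.IsSubcoalgebra N) ∧
    -- (3)
    (∀ N : Submodule k C,
      ComoduleDecomp.IsClosedSubcomodule C N ↔ ComoduleDecomp.IsWeakClosedSubcomodule C N) ∧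
    -- (4)
    (∀ N : Submodule k C,
      ComoduleDecomp.IsMinimalClosedSubcomodule C N ↔
        ComoduleDecomp.IsSimpleSubcoalgebra N) ∧
    -- (5)
    (∀ N L : Submodule k C, ComoduleDecomp.IsClosedSubcomodule C N →
      ComoduleDecomp.IsClosedSubcomodule C L →
        ComoduleDecomp.wedgeM C N L = ComoduleDecomp.wedgeC N L) ∧
    -- (6)
    (ComoduleDecomp.IsFull k C C ∧ ComoduleDecomp.IsWRelationalHereditary k C C ∧
      ComoduleDecomp.IsComponentFaithful k C C) ∧
    -- (7)
    ((∃! S : Set (Submodule k C), ComoduleDecomp.IsWeakClosedIndecDecomposition C S) ∧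
      (∃! S : Set (Submodule k C), ComoduleDecomp.IsIndecDecompositionC S) ∧
      ∀ S : Set (Submodule k C), ComoduleDecomp.IsWeakClosedIndecDecomposition C S ↔
        ComoduleDecomp.IsIndecDecompositionC S) := by
  open ComoduleDecomp in
  refine ⟨fun X _ => perpC_eq_perpM X,
    fun N hN => (closureM_eq_lactSpan hN).trans (coeffSpace_eq_lactSpan hN).symm,
    fun F hF => ?_, fun N => isClosedSubcomodule_iff,
    fun N => isClosedSubcomodule_iff.trans isWeakClosedSubcomodule_iff.symm,
    fun N => isMinimalClosedSubcomodule_iff,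
    fun N L hN hL => wedgeM_eq_wedgeC (isClosedSubcomodule_iff.1 hN) (isClosedSubcomodule_iff.1 hL),
    ⟨isFull_regular, isWRelationalHereditary_regular, isComponentFaithful_regular⟩,
    ?_, ?_, fun S => isWeakClosedIndecDecomposition_iff⟩
  · rw [component_eq hF, coeffSpace_eq_lactSpan hF.isSubcomodule, hF.lactSpan_eq]
  · simp only [isWeakClosedIndecDecomposition_iff, isIndecDecompositionC_iff]
    exact existsUnique_eq
  · simp only [isIndecDecompositionC_iff]
    exact existsUnique_eq
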